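/- A (nonnegative Borel) measure $\mu$ on $\mathbf{R}$ is called exponentially integrable if $\int e_\lambda\, d\mu < +\infty$ for all $\lambda \in \mathbf{R}$, where $e_\lambda(x) = \exp(\lambda x)$. Let $M_{\exp}(\mathbf{R})$ be the set of exponentially integrable measures on $\mathbf{R}$, and let $P_{\exp}(\mathbf{R}) \subset M_{\exp}(\mathbf{R})$ be the set of exponentially integrable probability measures. For probability measures $\mu,\nu$ on $\mathbf{R}$ write $\mu \leq_{\mathrm{st}} \nu$ if $\mu[t,\infty) \leq \nu[t,\infty)$ for all $t \in \mathbf{R}$, and write $\mu \leq^*_{\mathrm{st}} \nu$ if there is an integer $n \geq 1$ such that $\mu^{*n} \leq_{\mathrm{st}} \nu^{*n}$, where $\mu^{*n}$ denotes the $n$-fold convolution power. Call $f : \mathbf{R} \to \mathbf{R}$ subexponential if there are constants $c, C$ with $|f(x)| \leq C \exp(c|x|)$ for all $x \in \mathbf{R}$. Let $\tau$ be the topology on $M_{\exp}(\mathbf{R})$ generated by the pseudometrics $(\mu,\nu) \mapsto \left|\int f\, d\mu - \int f\, d\nu\right|$, where $f$ ranges over the continuous subexponential functions. **Theorem.** Let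 $R \subset P_{\exp}(\mathbf{R})^2$ be the set of pairs $(\mu,\nu)$ of exponentially integrable probability measures such that $\mu \leq^*_{\mathrm{st}} \nu$. Then $$\overline{R} = \left\{ (\mu,\nu) \in P_{\exp}(\mathbf{R})^2 \;:\; \forall \lambda \geq 0,\ \int e_\lambda\, d\mu \leq \int e_\lambda\, d\nu \ \text{ and } \ \forall \lambda \leq 0,\ \int e_\lambda\, d\mu \geq \int e_\lambda\, d\nu \right\},$$ where the closure is taken in $M_{\exp}(\mathbf{R})^2$ with respect to the product topology of $\tau$ (equivalently in $P_{\exp}(\mathbf{R})^2$ with the subspace topology). -/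

import Mathlib

open MeasureTheory

noncomputable section

namespace StDom

/-- Stochastic domination: `μ[t,∞) ≤ ν[t,∞)` for all real `t`. -/
def StLE (μ ν : Measure ℝ) : Prop :=
  ∀ t : ℝ, μ (Set.Ici t) ≤ ν (Set.Ici t)

/-- The `n`-fold convolution power, with `μ^{*0} = δ₀`. -/
def convPow (μ : Measure ℝ) : ℕ → Measure ℝ
  | 0 => Measure.dirac 0
  | n + 1 => Measure.conv (convPow μ n) μ

/-- Some convolution power of `μ`, of order at least one, is stochastically dominated by the same
power of `ν`. -/
def StLEStar (μ ν : Measure ℝ) : Prop :=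
  ∃ n : ℕ, 1 ≤ n ∧ StLE (convPow μ n) (convPow ν n)

/-- All exponential functions `x ↦ exp (l * x)` are integrable. -/
def ExpIntegrable (μ : Measure ℝ) : Prop :=
  ∀ l : ℝ, Integrable (fun x : ℝ => Real.exp (l * x)) μ

def Subexponential (f : ℝ → ℝ) : Prop :=
  ∃ c C : ℝ, ∀ x : ℝ, |f x| ≤ C * Real.exp (c * |x|)

/-- The space of exponentially integrable measures on the real line. -/
def ExpMeasure : Type := {μ : Measure ℝ // ExpIntegrable μ}

/-- The underlying measure. -/
def ExpMeasure.meas (μ : ExpMeasure) : Measure ℝ := μ.1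

/-- Continuous subexponential functions. -/
def TestFun : Type := {f : ℝ → ℝ // Continuous f ∧ Subexponential f}

/-- The integral of a test function against an exponentially integrable measure is a genuine one. -/
theorem integrable_testFun (μ : ExpMeasure) (f : TestFun) : Integrable f.1 μ.meas := by
  obtain ⟨f, hf, c, C, h⟩ := f
  have hi : Integrable (fun x : ℝ => |C| * (Real.exp (c * x) + Real.exp (-c * x))) μ.meas :=
    ((μ.2 c).add (μ.2 (-c))).const_mul _
  refine hi.mono' hf.aestronglyMeasurable (Filter.Eventually.of_forall fun x => ?_)
  have h1 : Real.exp (c * |x|) ≤ Real.exp (c * x) + Real.exp (-c * x) := by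
    rcases abs_cases x with ⟨hx, _⟩ | ⟨hx, _⟩ <;> rw [hx]
    · linarith [Real.exp_pos (-c * x)]
    · rw [mul_neg, ← neg_mul]
      linarith [Real.exp_pos (c * x)]
  calc ‖f x‖ = |f x| := Real.norm_eq_abs _
    _ ≤ C * Real.exp (c * |x|) := h x
    _ ≤ |C| * Real.exp (c * |x|) := by gcongr; exact le_abs_self C
    _ ≤ _ := by gcongr

/-- The topology `τ` on exponentially integrable measures: the coarsest one making `μ ↦ ∫ f dμ`
continuous for every continuous subexponential `f`; equivalently, the one given by the
pseudometrics `|∫ f dμ - ∫ f dν|`. -/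
instance : TopologicalSpace ExpMeasure :=
  TopologicalSpace.induced (fun (μ : ExpMeasure) (f : TestFun) => ∫ x, f.1 x ∂μ.meas)
    Pi.topologicalSpace

/-- Pairs of exponentially integrable probability measures, as a subset of the pairs of
exponentially integrable measures. -/
def probPairs : Set (ExpMeasure × ExpMeasure) :=
  {p | IsProbabilityMeasure p.1.meas ∧ IsProbabilityMeasure p.2.meas}

/-- The graph of the relation `StLEStar` on exponentially integrable probability measures. -/
def relR : Set (ExpMeasure × ExpMeasure) :=
  {p | p ∈ probPairs ∧ StLEStar p.1.meas p.2.meas}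

end StDom

end

/-!
Write `K_μ l = log ∫ exp (l * x) dμ`. Since `K` of the `n`-th convolution power is `n * K`, the
Chernoff bound `μ^{*n}[n x, ∞) ≤ exp (-n (l x - K_μ l))` can be compared with a reverse bound for
`ν`: under `ν^{*n}` tilted by `l`, Chebyshev's inequality concentrates the mass near `n m`,
where `m` is the derivative of `K_ν` at `l`, and this gives
`ν^{*n}[n (m - δ), ∞) ≥ exp (n (K_ν l - l (m + δ))) / 2` for large `n`.

The two conditions on the moment generating functions say that the exponential mean `K_μ l / l` is
at most `K_ν l / l` for every `l`, the value at `0` being the ordinary mean. If all these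
inequalities are strict, `μ` is bounded above and `ν` charges the half-line beyond that bound, then
a compact interval of tilts `l` suffices and the two bounds show that the upper tails of `μ^{*n}`
are below those of `ν^{*n}` for large `n`, from a threshold strictly between `n` times the two means
on. Reflection handles the lower tails.

In general, replace `μ` by the law of `min X k - |Z| / (k + 1)` with `Z` an independent standard
Gaussian, and `ν` by the mirror image of this construction. This makes the exponential means
strictly ordered and provides the support conditions; as `k → ∞` the laws converge to `μ` and `ν`.
Conversely, stochastic domination of convolution powers orders the exponential means, which is a
closed condition.
-/

namespace StDom

open MeasureTheory ProbabilityTheory Filter Set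
open scoped Topology

variable {μ ν : Measure ℝ}

/-! ### Convolution powers and reflection -/

theorem mgf_conv (μ ν : Measure ℝ) [SFinite μ] [SFinite ν] (t : ℝ) :
    mgf id (μ ∗ ν) t = mgf id μ t * mgf id ν t := by
  simp only [mgf, id_eq, Measure.conv]
  rw [integral_map (by fun_prop) (by fun_prop), ← integral_prod_mul]
  simp only [mul_add, Real.exp_add]

theorem ExpIntegrable.conv (hμ : ExpIntegrable μ) (hν : ExpIntegrable ν) :
    ExpIntegrable (μ ∗ ν) := by
  intro t
  rw [Measure.conv, integrable_map_measure (by fun_prop) (by fun_prop)]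
  exact ((hμ t).mul_prod (hν t)).congr (ae_of_all _ fun p => by simp [mul_add, Real.exp_add])

instance [IsProbabilityMeasure μ] (n : ℕ) : IsProbabilityMeasure (convPow μ n) := by
  induction n with
  | zero => exact Measure.dirac.isProbabilityMeasure
  | succ n ih => exact Measure.probabilitymeasure_of_probabilitymeasures_conv _ _

theorem ExpIntegrable.convPow (hμ : ExpIntegrable μ) (n : ℕ) :
    ExpIntegrable (convPow μ n) := by
  induction n with
  | zero => exact fun t => integrable_dirac (by simp)
  | succ n ih => exact ih.conv hμ

theorem mgf_convPow (μ : Measure ℝ) [IsProbabilityMeasure μ] (n : ℕ) (t : ℝ) :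
    mgf id (convPow μ n) t = mgf id μ t ^ n := by
  induction n with
  | zero => simp [StDom.convPow, mgf]
  | succ n ih => rw [StDom.convPow, mgf_conv, ih, pow_succ]

theorem cgf_convPow (μ : Measure ℝ) [IsProbabilityMeasure μ] (n : ℕ) :
    cgf id (convPow μ n) = fun t => n * cgf id μ t := by
  funext t
  rw [cgf, mgf_convPow, Real.log_pow, cgf]

theorem ae_convPow_le {b : ℝ} (h : ∀ᵐ x ∂μ, x ≤ b) (n : ℕ) :
    ∀ᵐ x ∂convPow μ n, x ≤ n * b := by
  induction n with
  | zero => simp [StDom.convPow, ae_dirac_eq]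
  | succ n ih =>
    rw [StDom.convPow, Measure.conv, ae_map_iff (by fun_prop) measurableSet_Iic]
    filter_upwards [Measure.quasiMeasurePreserving_fst.ae ih,
      Measure.quasiMeasurePreserving_snd.ae h] with p h₁ h₂
    push_cast
    linarith

instance [IsProbabilityMeasure μ] : IsProbabilityMeasure μ.neg :=
  Measure.isProbabilityMeasure_map measurable_neg.aemeasurable

theorem mgf_measure_neg (μ : Measure ℝ) (t : ℝ) : mgf id μ.neg t = mgf id μ (-t) := by
  rw [← mgf_neg, Measure.neg_def, mgf_id_map (by fun_prop)]
  rfl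

theorem cgf_measure_neg (μ : Measure ℝ) (t : ℝ) : cgf id μ.neg t = cgf id μ (-t) := by
  simp only [cgf, mgf_measure_neg]

theorem ExpIntegrable.neg (hμ : ExpIntegrable μ) : ExpIntegrable μ.neg := by
  intro t
  rw [Measure.neg_def, integrable_map_measure (by fun_prop) (by fun_prop)]
  simpa [Function.comp_def] using hμ (-t)

theorem convPow_neg (μ : Measure ℝ) [IsProbabilityMeasure μ] (n : ℕ) :
    convPow μ.neg n = (convPow μ n).neg := by
  induction n with
  | zero => simp [convPow, Measure.neg_def, Measure.map_dirac]
  | succ n ih =>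
    rw [convPow, convPow, ih]
    exact (Measure.map_conv_addMonoidHom negAddMonoidHom measurable_neg).symm

/-! ### Exponential tilting -/

section Tilting

variable {Ω : Type*} {mΩ : MeasurableSpace Ω} {P : Measure Ω} [IsFiniteMeasure P]
  {X : Ω → ℝ} {t : ℝ}

theorem measureReal_tilted_le {a : ℝ} {A : Set Ω} (ht : 0 ≤ t)
    (hX : Integrable (fun ω => Real.exp (t * X ω)) P) (hA : ∀ ω ∈ A, X ω ≤ a) :
    (P.tilted (t * X ·)).real A ≤ Real.exp (t * a - cgf X P t) * P.real A := by
  have h : P.tilted (t * X ·) A ≤ ENNReal.ofReal (Real.exp (t * a - cgf X P t)) * P A := by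
    rw [tilted_mul_apply_cgf _ hX, ← setLIntegral_const]
    refine setLIntegral_mono measurable_const fun ω hω => ?_
    gcongr
    exact hA ω hω
  have hreal := ENNReal.toReal_mono (by finiteness) h
  rwa [ENNReal.toReal_mul, ENNReal.toReal_ofReal (Real.exp_nonneg _)] at hreal

/-- The mean and variance of `X` under the measure tilted by `t` are the first two derivatives of
its `cgf` at `t`, so Chebyshev's inequality applies to the tilted measure. -/
theorem exp_cgf_le_measureReal_ge [NeZero P] {δ : ℝ} (ht : 0 ≤ t)
    (hX : t ∈ interior (integrableExpSet X P)) (hδ : 0 < δ) :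
    (1 - iteratedDeriv 2 (cgf X P) t / δ ^ 2) *
        Real.exp (cgf X P t - t * (deriv (cgf X P) t + δ)) ≤
      P.real {ω | deriv (cgf X P) t - δ ≤ X ω} := by
  set m := deriv (cgf X P) t with hm
  set A := {ω | |X ω - m| < δ}
  have hint : Integrable (fun ω => Real.exp (t * X ω)) P :=
    interior_subset (s := integrableExpSet X P) hX
  have := isProbabilityMeasure_tilted hint
  have hcheb : (P.tilted (t * X ·)).real Aᶜ ≤ iteratedDeriv 2 (cgf X P) t / δ ^ 2 := by
    have h := meas_ge_le_variance_div_sq (memLp_tilted_mul hX 2) hδ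
    rw [variance_tilted_mul hX, integral_tilted_mul_self hX, ← hm] at h
    have hAc : Aᶜ = {ω | δ ≤ |X ω - m|} := by ext; simp [A]
    rw [hAc]
    refine ENNReal.toReal_le_of_le_ofReal ?_ h
    rw [← variance_tilted_mul hX]
    exact div_nonneg (variance_nonneg _ _) (sq_nonneg δ)
  have hcover : 1 ≤ (P.tilted (t * X ·)).real A + (P.tilted (t * X ·)).real Aᶜ := by
    simpa using measureReal_union_le (μ := P.tilted (t * X ·)) A Aᶜ
  have htilt : (P.tilted (t * X ·)).real A ≤ Real.exp (t * (m + δ) - cgf X P t) * P.real A :=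
    measureReal_tilted_le ht hint fun ω (hω : |X ω - m| < δ) => by linarith [(abs_lt.1 hω).2]
  calc _ ≤ Real.exp (t * (m + δ) - cgf X P t) * P.real A *
        Real.exp (cgf X P t - t * (m + δ)) := by gcongr; linarith
    _ = P.real A := by
        rw [mul_right_comm, ← Real.exp_add, sub_add_sub_cancel, sub_self, Real.exp_zero, one_mul]
    _ ≤ _ := measureReal_mono fun ω (hω : |X ω - m| < δ) => by
        rw [mem_ofPred_eq]
        linarith [(abs_lt.1 hω).1]

end Tilting

theorem ExpIntegrable.interior_integrableExpSet (h : ExpIntegrable μ) :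
    interior (integrableExpSet id μ) = univ := by
  rw [show integrableExpSet id μ = univ from eq_univ_of_forall h, interior_univ]

theorem ExpIntegrable.contDiff_cgf (h : ExpIntegrable μ) {n : WithTop ℕ∞} :
    ContDiff ℝ n (cgf id μ) := by
  have := analyticOnNhd_cgf (X := id) (μ := μ)
  rw [h.interior_integrableExpSet] at this
  exact this.contDiff

theorem measureReal_Ici_le_of_cgf [IsProbabilityMeasure μ] [IsProbabilityMeasure ν]
    (hμ : ExpIntegrable μ) (hν : ExpIntegrable ν) {l δ x : ℝ} (hl : 0 ≤ l) (hδ : 0 < δ)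
    (hvar : 2 * iteratedDeriv 2 (cgf id ν) l ≤ δ ^ 2)
    (hgap : Real.log 2 ≤ cgf id ν l - cgf id μ l - l * (deriv (cgf id ν) l + δ - x)) :
    μ.real (Ici x) ≤ ν.real (Ici (deriv (cgf id ν) l - δ)) := by
  have hhalf : (2 : ℝ)⁻¹ ≤ 1 - iteratedDeriv 2 (cgf id ν) l / δ ^ 2 := by
    have : iteratedDeriv 2 (cgf id ν) l / δ ^ 2 ≤ 2⁻¹ := by
      rw [div_le_iff₀ (by positivity)]
      linarith
    linarith
  calc μ.real (Ici x) ≤ Real.exp (-l * x + cgf id μ l) := measure_ge_le_exp_cgf x hl (hμ l)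
    _ ≤ Real.exp (-Real.log 2 + (cgf id ν l - l * (deriv (cgf id ν) l + δ))) := by
        rw [Real.exp_le_exp]
        linarith
    _ = 2⁻¹ * Real.exp (cgf id ν l - l * (deriv (cgf id ν) l + δ)) := by
        rw [Real.exp_add, Real.exp_neg, Real.exp_log two_pos]
    _ ≤ _ * Real.exp (cgf id ν l - l * (deriv (cgf id ν) l + δ)) := by gcongr
    _ ≤ ν.real (Ici (deriv (cgf id ν) l - δ)) :=
        exp_cgf_le_measureReal_ge hl (by simp [hν.interior_integrableExpSet]) hδ

theorem convPow_Ici_le_of_cgf [IsProbabilityMeasure μ] [IsProbabilityMeasure ν]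
    (hμ : ExpIntegrable μ) (hν : ExpIntegrable ν) {l δ x : ℝ} {n : ℕ} (hn : n ≠ 0)
    (hl : 0 ≤ l) (hδ : 0 < δ)
    (hvar : 2 * iteratedDeriv 2 (cgf id ν) l ≤ n * δ ^ 2)
    (hgap : Real.log 2 ≤ n * (cgf id ν l - cgf id μ l - l * (deriv (cgf id ν) l + δ - x))) :
    convPow μ n (Ici (n * x)) ≤ convPow ν n (Ici (n * (deriv (cgf id ν) l - δ))) := by
  have hderiv : deriv (cgf id (convPow ν n)) l = n * deriv (cgf id ν) l := by
    rw [cgf_convPow, deriv_const_mul_field]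
  have hderiv₂ : iteratedDeriv 2 (cgf id (convPow ν n)) l = n * iteratedDeriv 2 (cgf id ν) l := by
    rw [cgf_convPow, iteratedDeriv_const_mul_field]
  rw [← ENNReal.toReal_le_toReal (measure_ne_top _ _) (measure_ne_top _ _), mul_sub, ← hderiv]
  refine measureReal_Ici_le_of_cgf (hμ.convPow n) (hν.convPow n) hl (by positivity) ?_ ?_
  · rw [hderiv₂]
    nlinarith [(Nat.cast_nonneg n : (0 : ℝ) ≤ n)]
  · rw [hderiv, cgf_convPow, cgf_convPow]
    linarith

/-! ### Stochastic order and exponential means -/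

theorem measure_le_of_isUpperSet {α : Type*} [LinearOrder α] [TopologicalSpace α]
    [OrderClosedTopology α] [MeasurableSpace α] [OpensMeasurableSpace α] {μ ν : Measure α}
    [μ.InnerRegular] {S : Set α} (hS : IsUpperSet S) (h : ∀ t ∈ S, μ (Ici t) ≤ ν (Ici t)) :
    μ S ≤ ν S := by
  rw [hS.ordConnected.measurableSet.measure_eq_iSup_isCompact]
  refine iSup₂_le fun K hKS => iSup_le fun hK => ?_
  rcases K.eq_empty_or_nonempty with rfl | hne
  · simp
  obtain ⟨m, hm⟩ := hK.exists_isLeast hne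
  calc μ K ≤ μ (Ici m) := measure_mono hm.2
    _ ≤ ν (Ici m) := h m (hKS hm.1)
    _ ≤ ν S := measure_mono (hS.Ici_subset (hKS hm.1))

theorem stLE_of_forall_ge [IsProbabilityMeasure μ] [IsProbabilityMeasure ν] {s : ℝ}
    (hupper : ∀ t ≥ s, μ (Ici t) ≤ ν (Ici t))
    (hlower : ∀ t ≥ -s, ν.neg (Ici t) ≤ μ.neg (Ici t)) : StLE μ ν := by
  intro t
  rcases le_or_gt s t with hst | hts
  · exact hupper t hst
  have hIio : ν (Iio t) ≤ μ (Iio t) := by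
    have h : ν.neg (Ioi (-t)) ≤ μ.neg (Ioi (-t)) :=
      measure_le_of_isUpperSet (isUpperSet_Ioi _) fun u hu =>
        hlower u ((neg_lt_neg hts).trans hu).le
    simpa only [Measure.neg_apply, neg_Ioi, neg_neg] using h
  rw [← compl_Iio, prob_compl_eq_one_sub measurableSet_Iio, prob_compl_eq_one_sub measurableSet_Iio]
  gcongr

theorem StLE.neg [IsProbabilityMeasure μ] [IsProbabilityMeasure ν] (h : StLE μ ν) :
    StLE ν.neg μ.neg := by
  intro t
  have hIoi : μ (Ioi (-t)) ≤ ν (Ioi (-t)) :=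
    measure_le_of_isUpperSet (isUpperSet_Ioi _) fun u _ => h u
  rw [Measure.neg_apply, Measure.neg_apply, neg_Ici, ← compl_Ioi,
    prob_compl_eq_one_sub measurableSet_Ioi, prob_compl_eq_one_sub measurableSet_Ioi]
  gcongr

theorem StLE.lintegral_le [IsFiniteMeasure μ] (h : StLE μ ν) {f : ℝ → ℝ} (hf : Monotone f)
    (hf₀ : 0 ≤ f) : ∫⁻ x, ENNReal.ofReal (f x) ∂μ ≤ ∫⁻ x, ENNReal.ofReal (f x) ∂ν := by
  rw [lintegral_eq_lintegral_meas_le μ (ae_of_all _ hf₀) hf.measurable.aemeasurable,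
    lintegral_eq_lintegral_meas_le ν (ae_of_all _ hf₀) hf.measurable.aemeasurable]
  refine lintegral_mono fun t => measure_le_of_isUpperSet ?_ fun u _ => h u
  exact fun x y hxy hx => le_trans hx (hf hxy)

theorem StLE.mgf_le [IsFiniteMeasure μ] (h : StLE μ ν) (hν : ExpIntegrable ν) {l : ℝ}
    (hl : 0 ≤ l) : mgf id μ l ≤ mgf id ν l := by
  have hexp : Monotone fun x : ℝ => Real.exp (l * x) := fun x y hxy => by
    simp only
    gcongr
  rw [mgf, mgf, integral_eq_lintegral_of_nonneg_ae (ae_of_all _ fun x => Real.exp_nonneg _)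
    (by fun_prop), integral_eq_lintegral_of_nonneg_ae (ae_of_all _ fun x => Real.exp_nonneg _)
    (by fun_prop)]
  exact ENNReal.toReal_mono (hν l).lintegral_lt_top.ne
    (h.lintegral_le hexp fun x => Real.exp_nonneg _)

/-- The exponential mean `l⁻¹ * log ∫ exp (l * x) dμ`, continued to `l = 0` by the mean of `μ`. -/
noncomputable def expMean (μ : Measure ℝ) (l : ℝ) : ℝ := dslope (cgf id μ) 0 l

theorem mul_expMean (μ : Measure ℝ) [IsProbabilityMeasure μ] (l : ℝ) :
    l * expMean μ l = cgf id μ l := by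
  simpa [expMean] using sub_smul_dslope (cgf id μ) 0 l

theorem ExpIntegrable.integrable_id (h : ExpIntegrable μ) : Integrable (fun x => x) μ :=
  memLp_one_iff_integrable.1 <| memLp_of_mem_interior_integrableExpSet (X := id)
    (by simp [h.interior_integrableExpSet]) 1

theorem expMean_zero [IsProbabilityMeasure μ] (h : ExpIntegrable μ) :
    expMean μ 0 = ∫ x, x ∂μ := by
  rw [expMean, dslope_same, deriv_cgf_zero (by simp [h.interior_integrableExpSet])]
  simp

theorem ExpIntegrable.continuous_expMean (h : ExpIntegrable μ) : Continuous (expMean μ) := by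
  refine continuous_iff_continuousAt.2 fun l => ?_
  have hdiff := (h.contDiff_cgf (n := 1)).differentiable one_ne_zero
  rcases eq_or_ne l 0 with rfl | hl
  · exact continuousAt_dslope_same.2 hdiff.differentiableAt
  · exact (continuousAt_dslope_of_ne hl).2 hdiff.continuous.continuousAt

theorem expMean_neg (μ : Measure ℝ) (l : ℝ) : expMean μ.neg l = -expMean μ (-l) := by
  have hcgf : cgf id μ.neg = fun t => cgf id μ (-t) := funext (cgf_measure_neg μ)
  rcases eq_or_ne l 0 with rfl | hl
  · simp [expMean, hcgf, deriv_comp_neg]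
  · simp [expMean, hcgf, dslope_of_ne, hl, slope_def_field, div_neg]

theorem expMean_convPow (μ : Measure ℝ) [IsProbabilityMeasure μ] (n : ℕ) (l : ℝ) :
    expMean (convPow μ n) l = n * expMean μ l := by
  rcases eq_or_ne l 0 with rfl | hl
  · rw [expMean, cgf_convPow, dslope_same, deriv_const_mul_field, expMean, dslope_same]
  · refine mul_left_cancel₀ hl ?_
    rw [mul_expMean, cgf_convPow, mul_left_comm, mul_expMean]

theorem mgf_le_mgf_iff [IsProbabilityMeasure μ] [IsProbabilityMeasure ν] (hμ : ExpIntegrable μ)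
    (hν : ExpIntegrable ν) {l : ℝ} :
    mgf id μ l ≤ mgf id ν l ↔ l * expMean μ l ≤ l * expMean ν l := by
  have hμpos : 0 < mgf id μ l := mgf_pos (hμ l)
  have hνpos : 0 < mgf id ν l := mgf_pos (hν l)
  rw [mul_expMean, mul_expMean, cgf, cgf, Real.log_le_log_iff hμpos hνpos]

theorem forall_expMean_le_iff [IsProbabilityMeasure μ] [IsProbabilityMeasure ν]
    (hμ : ExpIntegrable μ) (hν : ExpIntegrable ν) :
    (∀ l, expMean μ l ≤ expMean ν l) ↔
      (∀ l, 0 ≤ l → mgf id μ l ≤ mgf id ν l) ∧ ∀ l ≤ 0, mgf id ν l ≤ mgf id μ l := by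
  constructor
  · intro h
    exact ⟨fun l hl => (mgf_le_mgf_iff hμ hν).2 (mul_le_mul_of_nonneg_left (h l) hl),
      fun l hl => (mgf_le_mgf_iff hν hμ).2 (mul_le_mul_of_nonpos_left (h l) hl)⟩
  · rintro ⟨hpos, hneg⟩
    have hne : ({0}ᶜ : Set ℝ) ⊆ {l | expMean μ l ≤ expMean ν l} := by
      intro l hl
      rcases lt_or_gt_of_ne hl with hl | hl
      · exact (mul_le_mul_left_of_neg hl).1 ((mgf_le_mgf_iff hν hμ).1 (hneg l hl.le))
      · exact le_of_mul_le_mul_left ((mgf_le_mgf_iff hμ hν).1 (hpos l hl.le)) hl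
    have hclosed := isClosed_le hμ.continuous_expMean hν.continuous_expMean
    have := hclosed.closure_subset_iff.2 hne
    rw [(dense_compl_singleton 0).closure_eq] at this
    exact fun l => this (mem_univ l)

theorem StLE.expMean_le [IsProbabilityMeasure μ] [IsProbabilityMeasure ν] (h : StLE μ ν)
    (hμ : ExpIntegrable μ) (hν : ExpIntegrable ν) (l : ℝ) : expMean μ l ≤ expMean ν l := by
  refine (forall_expMean_le_iff hμ hν).2 ⟨fun l hl => h.mgf_le hν hl, fun l hl => ?_⟩ l
  simpa only [mgf_measure_neg, neg_neg] using h.neg.mgf_le hμ.neg (neg_nonneg.2 hl)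

theorem StLEStar.expMean_le [IsProbabilityMeasure μ] [IsProbabilityMeasure ν] (h : StLEStar μ ν)
    (hμ : ExpIntegrable μ) (hν : ExpIntegrable ν) (l : ℝ) : expMean μ l ≤ expMean ν l := by
  obtain ⟨n, hn, h⟩ := h
  have := h.expMean_le (hμ.convPow n) (hν.convPow n) l
  rw [expMean_convPow, expMean_convPow] at this
  exact le_of_mul_le_mul_left this (by exact_mod_cast hn)

theorem integral_lt_integral_of_ae_lt {Ω : Type*} {mΩ : MeasurableSpace Ω} {P : Measure Ω}
    [NeZero P] {f g : Ω → ℝ} (hf : Integrable f P) (hg : Integrable g P)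
    (hfg : ∀ᵐ ω ∂P, f ω < g ω) : ∫ ω, f ω ∂P < ∫ ω, g ω ∂P := by
  rw [← sub_pos, ← integral_sub hg hf,
    integral_pos_iff_support_of_nonneg_ae (hfg.mono fun ω h => (sub_pos.2 h).le) (hg.sub hf)]
  have hsupp : Function.support (fun ω => g ω - f ω) =ᵐ[P] univ :=
    eventuallyEq_univ.2 (hfg.mono fun ω h => (sub_pos.2 h).ne')
  rw [measure_congr hsupp]
  exact NeZero.pos _

theorem expMean_map_lt_of_ae_lt {Ω : Type*} {mΩ : MeasurableSpace Ω} {P : Measure Ω}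
    [IsProbabilityMeasure P] {X Y : Ω → ℝ} (hX : AEMeasurable X P) (hY : AEMeasurable Y P)
    (hXexp : ExpIntegrable (P.map X)) (hYexp : ExpIntegrable (P.map Y))
    (hXY : ∀ᵐ ω ∂P, X ω < Y ω) (l : ℝ) : expMean (P.map X) l < expMean (P.map Y) l := by
  have := Measure.isProbabilityMeasure_map hX
  have := Measure.isProbabilityMeasure_map hY
  have hexp {Z : Ω → ℝ} (hZ : AEMeasurable Z P) (hZexp : ExpIntegrable (P.map Z)) (s : ℝ) :
      Integrable (fun ω => Real.exp (s * Z ω)) P :=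
    (integrable_map_measure (by fun_prop) hZ).1 (hZexp s)
  rcases lt_trichotomy l 0 with hl | rfl | hl
  · refine lt_of_mul_lt_mul_of_nonpos_left ?_ hl.le
    rw [← lt_iff_lt_of_le_iff_le (mgf_le_mgf_iff hXexp hYexp), mgf_id_map hX, mgf_id_map hY]
    refine integral_lt_integral_of_ae_lt (hexp hY hYexp l) (hexp hX hXexp l) ?_
    filter_upwards [hXY] with ω hω
    exact Real.exp_lt_exp.2 (mul_lt_mul_of_neg_left hω hl)
  · rw [expMean_zero hXexp, expMean_zero hYexp, integral_map hX (by fun_prop),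
      integral_map hY (by fun_prop)]
    exact integral_lt_integral_of_ae_lt
      ((integrable_map_measure (by fun_prop) hX).1 hXexp.integrable_id)
      ((integrable_map_measure (by fun_prop) hY).1 hYexp.integrable_id) hXY
  · refine lt_of_mul_lt_mul_left ?_ hl.le
    rw [← lt_iff_lt_of_le_iff_le (mgf_le_mgf_iff hYexp hXexp), mgf_id_map hX, mgf_id_map hY]
    refine integral_lt_integral_of_ae_lt (hexp hX hXexp l) (hexp hY hYexp l) ?_
    filter_upwards [hXY] with ω hω
    exact Real.exp_lt_exp.2 (mul_lt_mul_of_pos_left hω hl)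

/-! ### Tails of large convolution powers -/

theorem eventually_convPow_Ici_le_of_cgf [IsProbabilityMeasure μ] [IsProbabilityMeasure ν]
    (hμ : ExpIntegrable μ) (hν : ExpIntegrable ν) {l₀ L δ η : ℝ} (hl₀ : 0 ≤ l₀) (hδ : 0 < δ)
    (hη : 0 < η) :
    ∀ᶠ n : ℕ in atTop, ∀ l ∈ Icc l₀ L, ∀ x,
      η ≤ cgf id ν l - cgf id μ l - l * (deriv (cgf id ν) l + δ - x) →
        convPow μ n (Ici (n * x)) ≤ convPow ν n (Ici (n * (deriv (cgf id ν) l - δ))) := by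
  obtain ⟨M, hM⟩ := isCompact_Icc (a := l₀) (b := L) |>.bddAbove_image
    ((hν.contDiff_cgf (n := 2)).continuous_iteratedDeriv 2 le_rfl).continuousOn
  have hvar : ∀ᶠ n : ℕ in atTop, 2 * M ≤ n * δ ^ 2 :=
    (tendsto_natCast_atTop_atTop.atTop_mul_const (by positivity)).eventually_ge_atTop _
  have hgap : ∀ᶠ n : ℕ in atTop, Real.log 2 ≤ n * η :=
    (tendsto_natCast_atTop_atTop.atTop_mul_const hη).eventually_ge_atTop _
  filter_upwards [hvar, hgap, eventually_ne_atTop 0] with n hvar hgap hn l hl x hx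
  refine convPow_Ici_le_of_cgf hμ hν hn (hl₀.trans hl.1) hδ ?_ ?_
  · linarith [hM (mem_image_of_mem _ hl)]
  · exact hgap.trans (by gcongr)

theorem exists_pos_lt_cgf_sub_cgf [IsProbabilityMeasure μ] [IsProbabilityMeasure ν]
    (hμ : ExpIntegrable μ) (hν : ExpIntegrable ν) {x : ℝ} (hx : expMean μ 0 < x) :
    ∃ l > 0, l * (deriv (cgf id ν) l - x) < cgf id ν l - cgf id μ l := by
  have hcont : Continuous fun l => expMean ν l - expMean μ l - deriv (cgf id ν) l + x :=
    ((hν.continuous_expMean.sub hμ.continuous_expMean).sub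
      ((hν.contDiff_cgf (n := 1)).continuous_deriv le_rfl)).add continuous_const
  have hzero : 0 < expMean ν 0 - expMean μ 0 - deriv (cgf id ν) 0 + x := by
    rw [show expMean ν 0 = deriv (cgf id ν) 0 from dslope_same _ _]
    linarith
  have hnear : ∀ᶠ l in 𝓝[>] 0, 0 < expMean ν l - expMean μ l - deriv (cgf id ν) l + x :=
    (hcont.continuousAt.eventually_const_lt hzero).filter_mono nhdsWithin_le_nhds
  obtain ⟨l, hl, hl₀⟩ := (hnear.and self_mem_nhdsWithin).exists
  refine ⟨l, hl₀, ?_⟩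
  rw [← mul_expMean, ← mul_expMean, ← mul_sub, mul_lt_mul_iff_right₀ hl₀]
  linarith

theorem exists_gt_measure_Ici_ne_zero [μ.InnerRegular] {b : ℝ} (h : μ (Ioi b) ≠ 0) :
    ∃ c > b, μ (Ici c) ≠ 0 := by
  by_contra! hzero
  refine h (nonpos_iff_eq_zero.1 ?_)
  exact measure_le_of_isUpperSet (ν := 0) (isUpperSet_Ioi b) fun c hc => (hzero c hc).le

theorem ExpIntegrable.exists_lt_deriv_cgf [IsProbabilityMeasure ν] (h : ExpIntegrable ν) {b : ℝ}
    (hb : ν (Ioi b) ≠ 0) (l : ℝ) : ∃ L > l, b < deriv (cgf id ν) L := by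
  obtain ⟨c, hbc, hc⟩ := exists_gt_measure_Ici_ne_zero hb
  have hpos : 0 < ν.real (Ici c) := ENNReal.toReal_pos hc (measure_ne_top _ _)
  have hlower (t : ℝ) (ht : 0 ≤ t) : t * c + Real.log (ν.real (Ici c)) ≤ cgf id ν t := by
    have := (Real.log_le_iff_le_exp hpos).2 (measure_ge_le_exp_cgf (X := id) c ht (h t))
    linarith
  have hlin : ∀ᶠ t in atTop, cgf id ν l - b * l - Real.log (ν.real (Ici c)) < t * (c - b) :=
    (tendsto_id.atTop_mul_const (sub_pos.2 hbc)).eventually_gt_atTop _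
  obtain ⟨t, ht, hlt, ht₀⟩ :=
    (hlin.and ((eventually_gt_atTop l).and (eventually_ge_atTop 0))).exists
  have hdiff := (h.contDiff_cgf (n := 1)).differentiable one_ne_zero
  obtain ⟨L, hL, hderiv⟩ := exists_deriv_eq_slope (cgf id ν) hlt hdiff.continuous.continuousOn
    hdiff.differentiableOn
  refine ⟨L, hL.1, ?_⟩
  rw [hderiv, lt_div_iff₀ (sub_pos.2 hlt)]
  linarith [hlower t ht₀]

theorem exists_tilt_interval [IsProbabilityMeasure μ] [IsProbabilityMeasure ν]
    (hμ : ExpIntegrable μ) (hν : ExpIntegrable ν) (hlt : ∀ l > 0, expMean μ l < expMean ν l)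
    {b x₀ : ℝ} (hb : ν (Ioi b) ≠ 0) (hx₀ : expMean μ 0 < x₀) :
    ∃ l₀ L δ η : ℝ, 0 ≤ l₀ ∧ l₀ ≤ L ∧ 0 < δ ∧ 0 < η ∧
      η ≤ cgf id ν l₀ - cgf id μ l₀ - l₀ * (deriv (cgf id ν) l₀ + δ - x₀) ∧
      (∀ l ∈ Icc l₀ L, η ≤ cgf id ν l - cgf id μ l - l * (2 * δ)) ∧
      b ≤ deriv (cgf id ν) L - δ := by
  obtain ⟨l₀, hl₀, hgap₀⟩ := exists_pos_lt_cgf_sub_cgf hμ hν hx₀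
  obtain ⟨L, hL, hbL⟩ := hν.exists_lt_deriv_cgf hb l₀
  obtain ⟨l₁, hl₁, hmin⟩ := isCompact_Icc.exists_isMinOn (nonempty_Icc.2 hL.le)
    ((hν.contDiff_cgf (n := 0)).continuous.sub (hμ.contDiff_cgf (n := 0)).continuous).continuousOn
  have hgap₁ : 0 < cgf id ν l₁ - cgf id μ l₁ := by
    have hl₁pos : 0 < l₁ := hl₀.trans_le hl₁.1
    rw [← mul_expMean, ← mul_expMean, ← mul_sub]
    exact mul_pos hl₁pos (sub_pos.2 (hlt l₁ hl₁pos))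
  have hLpos : 0 < L := hl₀.trans hL
  obtain ⟨η, hη, hη₀⟩ := exists_between (lt_min
    (half_pos (sub_pos.2 hgap₀)) (half_pos hgap₁))
  obtain ⟨δ, hδ, hδ₀⟩ := exists_between (lt_min
    (show 0 < η / (2 * L) by positivity) (sub_pos.2 hbL))
  rw [lt_min_iff] at hη₀ hδ₀
  have hLδ : L * (2 * δ) < η := by
    have := (lt_div_iff₀ (by positivity)).1 hδ₀.1
    linarith
  have hlδ {l : ℝ} (hl : l ≤ L) : l * (2 * δ) ≤ L * (2 * δ) := by gcongr
  refine ⟨l₀, L, δ, η, hl₀.le, hL.le, hδ, hη, ?_, fun l hl => ?_, by linarith⟩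
  · nlinarith [hlδ hL.le, mul_pos hl₀ hδ]
  · have : cgf id ν l₁ - cgf id μ l₁ ≤ cgf id ν l - cgf id μ l := hmin hl
    linarith [hlδ hl.2]

/-- Below the range of tilted means over `[l₀, L]` the bound at `x₀` suffices, within that range `l`
is chosen with tilted mean `x + δ`, and above it the tail of `convPow μ n` vanishes. -/
theorem eventually_forall_ge_convPow_Ici_le [IsProbabilityMeasure μ] [IsProbabilityMeasure ν]
    (hμ : ExpIntegrable μ) (hν : ExpIntegrable ν) (hlt : ∀ l > 0, expMean μ l < expMean ν l)
    {b x₀ : ℝ} (hμb : ∀ᵐ x ∂μ, x ≤ b) (hνb : ν (Ioi b) ≠ 0) (hx₀ : expMean μ 0 < x₀) :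
    ∀ᶠ n : ℕ in atTop, ∀ x ≥ x₀, convPow μ n (Ici (n * x)) ≤ convPow ν n (Ici (n * x)) := by
  obtain ⟨l₀, L, δ, η, hl₀, hL, hδ, hη, hη₀, hηl, hbL⟩ := exists_tilt_interval hμ hν hlt hνb hx₀
  filter_upwards [eventually_convPow_Ici_le_of_cgf hμ hν hl₀ hδ hη (L := L),
    eventually_gt_atTop 0] with n htilt hn x hx
  rcases le_total x (deriv (cgf id ν) l₀ - δ) with hxl₀ | hl₀x
  · calc convPow μ n (Ici (n * x)) ≤ convPow μ n (Ici (n * x₀)) := by gcongr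
      _ ≤ convPow ν n (Ici (n * (deriv (cgf id ν) l₀ - δ))) :=
          htilt l₀ (left_mem_Icc.2 hL) x₀ hη₀
      _ ≤ convPow ν n (Ici (n * x)) := by gcongr
  rcases le_or_gt x (deriv (cgf id ν) L - δ) with hxL | hLx
  · obtain ⟨l, hl, hlx⟩ := intermediate_value_Icc hL
      ((hν.contDiff_cgf (n := 1)).continuous_deriv le_rfl).continuousOn
      (show x + δ ∈ Icc _ _ from ⟨by linarith, by linarith⟩)
    have hle := htilt l hl x (by rw [hlx]; linarith [hηl l hl])
    rwa [hlx, add_sub_cancel_right] at hle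
  · have hzero : convPow μ n (Ici (n * x)) = 0 := by
      refine measure_mono_null (fun y hy => ?_) (ae_iff.1 (ae_convPow_le hμb n))
      have : (n : ℝ) * b < n * x := by
        gcongr
        linarith
      exact not_le.2 (this.trans_le hy)
    simp [hzero]

theorem stLEStar_of_expMean_lt [IsProbabilityMeasure μ] [IsProbabilityMeasure ν]
    (hμ : ExpIntegrable μ) (hν : ExpIntegrable ν) (hlt : ∀ l, expMean μ l < expMean ν l)
    {a b : ℝ} (hμb : ∀ᵐ x ∂μ, x ≤ b) (hνb : ν (Ioi b) ≠ 0) (hνa : ∀ᵐ x ∂ν, a ≤ x)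
    (hμa : μ (Iio a) ≠ 0) : StLEStar μ ν := by
  obtain ⟨x₀, hμx₀, hx₀ν⟩ := exists_between (hlt 0)
  have hupper := eventually_forall_ge_convPow_Ici_le hμ hν (fun l _ => hlt l) hμb hνb hμx₀
  have hlower := eventually_forall_ge_convPow_Ici_le (b := -a) (x₀ := -x₀) hν.neg hμ.neg
    (fun l _ => by simpa only [expMean_neg] using neg_lt_neg (hlt (-l)))
    ((ae_map_iff measurable_neg.aemeasurable measurableSet_Iic).2
      (hνa.mono fun x hx => neg_le_neg hx))
    (by simpa [Measure.neg_apply] using hμa) (by simpa [expMean_neg] using hx₀ν)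
  obtain ⟨n, hupper, hlower, hn⟩ := (hupper.and (hlower.and (eventually_ge_atTop 1))).exists
  have hn₀ : (0 : ℝ) < n := by exact_mod_cast hn
  refine ⟨n, hn, stLE_of_forall_ge (s := n * x₀) (fun t ht => ?_) fun t ht => ?_⟩
  · simpa [mul_div_cancel₀, hn₀.ne'] using hupper (t / n) ((le_div_iff₀' hn₀).2 ht)
  · rw [← mul_neg] at ht
    simpa [mul_div_cancel₀, hn₀.ne', convPow_neg] using
      hlower (t / n) ((le_div_iff₀' hn₀).2 ht)

/-! ### Approximation by truncation and noise -/

theorem Subexponential.exists_nonneg {f : ℝ → ℝ} (hf : Subexponential f) :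
    ∃ c C : ℝ, 0 ≤ c ∧ 0 ≤ C ∧ ∀ x, |f x| ≤ C * Real.exp (c * |x|) := by
  obtain ⟨c, C, h⟩ := hf
  refine ⟨|c|, |C|, abs_nonneg c, abs_nonneg C, fun x => (h x).trans ?_⟩
  gcongr <;> exact le_abs_self _

section Dominated

variable {Ω : Type*} {mΩ : MeasurableSpace Ω} {P : Measure Ω} {Z : Ω → ℝ}

theorem expIntegrable_map_of_abs_le {X : Ω → ℝ} (hX : AEMeasurable X P)
    (hXZ : ∀ᵐ ω ∂P, |X ω| ≤ Z ω) (hZ : ∀ c, Integrable (fun ω => Real.exp (c * Z ω)) P) :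
    ExpIntegrable (P.map X) := by
  intro l
  rw [integrable_map_measure (by fun_prop) hX]
  refine (hZ |l|).mono' (by fun_prop) (hXZ.mono fun ω hω => ?_)
  rw [Function.comp_apply, Real.norm_eq_abs, Real.abs_exp, Real.exp_le_exp]
  calc l * X ω ≤ |l| * |X ω| := (le_abs_self _).trans_eq (abs_mul _ _)
    _ ≤ |l| * Z ω := by gcongr

theorem tendsto_integral_map_of_abs_le {X : ℕ → Ω → ℝ} {Y : Ω → ℝ} {f : ℝ → ℝ}
    (hX : ∀ k, AEMeasurable (X k) P) (hY : AEMeasurable Y P)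
    (hXZ : ∀ k, ∀ᵐ ω ∂P, |X k ω| ≤ Z ω) (hZ : ∀ c, Integrable (fun ω => Real.exp (c * Z ω)) P)
    (hXY : ∀ᵐ ω ∂P, Tendsto (X · ω) atTop (𝓝 (Y ω))) (hfc : Continuous f)
    (hf : Subexponential f) :
    Tendsto (fun k => ∫ x, f x ∂P.map (X k)) atTop (𝓝 (∫ x, f x ∂P.map Y)) := by
  obtain ⟨c, C, hc, hC, hbound⟩ := hf.exists_nonneg
  rw [integral_map hY hfc.aestronglyMeasurable]
  simp only [fun k => integral_map (hX k) hfc.aestronglyMeasurable]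
  refine tendsto_integral_of_dominated_convergence (fun ω => C * Real.exp (c * Z ω))
    (fun k => (hfc.measurable.comp_aemeasurable (hX k)).aestronglyMeasurable)
    ((hZ c).const_mul C) (fun k => (hXZ k).mono fun ω hω => ?_)
    (hXY.mono fun ω hω => (hfc.tendsto _).comp hω)
  exact (hbound _).trans (by gcongr)

end Dominated

/-- A lower approximation of `μ`: the law of `min X k - |Z| / (k + 1)`, where `X` has law `μ` and
`Z` is an independent standard Gaussian variable. It is supported in `(-∞, k]`, unbounded below, and
strictly smaller than `μ` in exponential mean. -/
noncomputable def lowerApprox (μ : Measure ℝ) (k : ℕ) : Measure ℝ :=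
  (μ.prod (gaussianReal 0 1)).map fun p => min p.1 (k : ℝ) - |p.2| / (k + 1)

/-- The mirror image of `lowerApprox`: it is supported in `[-k, ∞)`, unbounded above, and strictly
larger than `ν` in exponential mean. -/
noncomputable def upperApprox (ν : Measure ℝ) (k : ℕ) : Measure ℝ := (lowerApprox ν.neg k).neg

instance [IsProbabilityMeasure μ] (k : ℕ) : IsProbabilityMeasure (lowerApprox μ k) :=
  Measure.isProbabilityMeasure_map (by fun_prop)

instance [IsProbabilityMeasure ν] (k : ℕ) : IsProbabilityMeasure (upperApprox ν k) :=
  inferInstanceAs (IsProbabilityMeasure (lowerApprox ν.neg k).neg)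

theorem abs_min_sub_le (x z : ℝ) (k : ℕ) : |min x (k : ℝ) - |z| / (k + 1)| ≤ |x| + |z| := by
  have hz : |z| / ((k : ℝ) + 1) ≤ |z| := div_le_self (abs_nonneg z) (by simp)
  have hz₀ : 0 ≤ |z| / ((k : ℝ) + 1) := by positivity
  have hmin : |min x (k : ℝ)| ≤ |x| := by
    rcases le_total x (k : ℝ) with h | h
    · rw [min_eq_left h]
    · rw [min_eq_right h, Nat.abs_cast]
      exact h.trans (le_abs_self x)
  calc |min x (k : ℝ) - |z| / (k + 1)| ≤ |min x (k : ℝ)| + |(|z| / (k + 1))| := abs_sub _ _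
    _ ≤ |x| + |z| := by
      rw [abs_of_nonneg hz₀]
      gcongr

theorem tendsto_min_sub (x z : ℝ) :
    Tendsto (fun k : ℕ => min x (k : ℝ) - |z| / (k + 1)) atTop (𝓝 x) := by
  have hmin : Tendsto (fun k : ℕ => min x (k : ℝ)) atTop (𝓝 x) :=
    tendsto_const_nhds.congr' <| (tendsto_natCast_atTop_atTop.eventually_ge_atTop x).mono
      fun k hk => (min_eq_left hk).symm
  have hnoise : Tendsto (fun k : ℕ => |z| / ((k : ℝ) + 1)) atTop (𝓝 0) :=
    tendsto_const_nhds.div_atTop (tendsto_natCast_atTop_atTop.atTop_add tendsto_const_nhds)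
  simpa using hmin.sub hnoise

theorem expIntegrable_gaussianReal (m : ℝ) (v : NNReal) : ExpIntegrable (gaussianReal m v) :=
  fun l => integrable_exp_mul_gaussianReal l

theorem ExpIntegrable.integrable_exp_mul_abs (h : ExpIntegrable μ) (c : ℝ) :
    Integrable (fun x => Real.exp (c * |x|)) μ :=
  ProbabilityTheory.integrable_exp_mul_abs (h c) (h (-c))

theorem ExpIntegrable.integrable_exp_mul_abs_add_abs (hμ : ExpIntegrable μ)
    (hν : ExpIntegrable ν) (c : ℝ) :
    Integrable (fun p : ℝ × ℝ => Real.exp (c * (|p.1| + |p.2|))) (μ.prod ν) := by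
  simpa only [mul_add, Real.exp_add] using
    (hμ.integrable_exp_mul_abs c).mul_prod (hν.integrable_exp_mul_abs c)

theorem ExpIntegrable.lowerApprox (h : ExpIntegrable μ) (k : ℕ) :
    ExpIntegrable (lowerApprox μ k) :=
  expIntegrable_map_of_abs_le (by fun_prop) (ae_of_all _ fun p => abs_min_sub_le p.1 p.2 k)
    (h.integrable_exp_mul_abs_add_abs (expIntegrable_gaussianReal 0 1))

theorem ExpIntegrable.upperApprox (h : ExpIntegrable ν) (k : ℕ) :
    ExpIntegrable (upperApprox ν k) :=
  (h.neg.lowerApprox k).neg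

theorem tendsto_integral_lowerApprox (h : ExpIntegrable μ) {f : ℝ → ℝ}
    (hfc : Continuous f) (hf : Subexponential f) :
    Tendsto (fun k => ∫ x, f x ∂lowerApprox μ k) atTop (𝓝 (∫ x, f x ∂μ)) := by
  have hfst : (μ.prod (gaussianReal 0 1)).map Prod.fst = μ := by simp
  nth_rw 2 [← hfst]
  exact tendsto_integral_map_of_abs_le (fun k => by fun_prop) (by fun_prop)
    (fun k => ae_of_all _ fun p => abs_min_sub_le p.1 p.2 k)
    (h.integrable_exp_mul_abs_add_abs (expIntegrable_gaussianReal 0 1))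
    (ae_of_all _ fun p => tendsto_min_sub p.1 p.2) hfc hf

theorem tendsto_integral_upperApprox (h : ExpIntegrable ν) {f : ℝ → ℝ}
    (hfc : Continuous f) (hf : Subexponential f) :
    Tendsto (fun k => ∫ x, f x ∂upperApprox ν k) atTop (𝓝 (∫ x, f x ∂ν)) := by
  have hneg (ρ : Measure ℝ) (g : ℝ → ℝ) : ∫ x, g x ∂ρ.neg = ∫ x, g (-x) ∂ρ :=
    integral_map_equiv (MeasurableEquiv.neg ℝ) g
  have hf' : Subexponential fun x => f (-x) := by
    obtain ⟨c, C, hbound⟩ := hf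
    exact ⟨c, C, fun x => by simpa using hbound (-x)⟩
  simpa only [upperApprox, hneg, Function.comp_apply, neg_neg] using
    tendsto_integral_lowerApprox h.neg (hfc.comp continuous_neg) hf'

theorem ae_lowerApprox_le (μ : Measure ℝ) (k : ℕ) : ∀ᵐ x ∂lowerApprox μ k, x ≤ (k : ℝ) := by
  refine (ae_map_iff (by fun_prop) measurableSet_Iic).2 (ae_of_all _ fun p => ?_)
  have : 0 ≤ |p.2| / ((k : ℝ) + 1) := by positivity
  linarith [min_le_right p.1 (k : ℝ)]

theorem ae_le_upperApprox (ν : Measure ℝ) (k : ℕ) : ∀ᵐ x ∂upperApprox ν k, -(k : ℝ) ≤ x :=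
  (ae_map_iff measurable_neg.aemeasurable measurableSet_Ici).2
    ((ae_lowerApprox_le ν.neg k).mono fun _ hx => neg_le_neg hx)

theorem gaussianReal_Ioi_ne_zero (m : ℝ) {v : NNReal} (hv : v ≠ 0) (a : ℝ) :
    gaussianReal m v (Ioi a) ≠ 0 := fun h => by
  simpa using gaussianReal_absolutelyContinuous' m hv h

theorem lowerApprox_Iio_ne_zero (μ : Measure ℝ) [IsProbabilityMeasure μ] (k : ℕ) (a : ℝ) :
    lowerApprox μ k (Iio a) ≠ 0 := by
  rw [lowerApprox, Measure.map_apply (by fun_prop) measurableSet_Iio]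
  have hsub : univ ×ˢ Ioi ((k - a) * (k + 1)) ⊆
      (fun p : ℝ × ℝ => min p.1 (k : ℝ) - |p.2| / (k + 1)) ⁻¹' Iio a := by
    rintro ⟨x, z⟩ ⟨-, hz⟩
    have : k - a < |z| / (k + 1) := by
      rw [lt_div_iff₀ (by positivity)]
      exact hz.trans_le (le_abs_self z)
    simp only [mem_preimage, mem_Iio]
    linarith [min_le_right x (k : ℝ)]
  refine fun h => gaussianReal_Ioi_ne_zero 0 one_ne_zero ((k - a) * (k + 1)) ?_
  simpa using measure_mono_null hsub h

theorem upperApprox_Ioi_ne_zero (ν : Measure ℝ) [IsProbabilityMeasure ν] (k : ℕ) (b : ℝ) :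
    upperApprox ν k (Ioi b) ≠ 0 := by
  simpa [upperApprox, Measure.neg_apply] using lowerApprox_Iio_ne_zero ν.neg k (-b)

theorem expMean_lowerApprox_lt [IsProbabilityMeasure μ] (h : ExpIntegrable μ) (k : ℕ) (l : ℝ) :
    expMean (lowerApprox μ k) l < expMean μ l := by
  have hfst : (μ.prod (gaussianReal 0 1)).map Prod.fst = μ := by simp
  have hnoise : ∀ᵐ p ∂μ.prod (gaussianReal 0 1), p.2 ≠ 0 := by
    have := nullSingletonClass_gaussianReal (μ := 0) (one_ne_zero (α := NNReal))
    exact Measure.quasiMeasurePreserving_snd.ae (Measure.ae_ne _ 0)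
  nth_rw 2 [← hfst]
  refine expMean_map_lt_of_ae_lt (by fun_prop) (by fun_prop) (h.lowerApprox k)
    (by rwa [hfst]) (hnoise.mono fun p hp => ?_) l
  have : 0 < |p.2| / ((k : ℝ) + 1) := by positivity
  linarith [min_le_left p.1 (k : ℝ)]

theorem lt_expMean_upperApprox [IsProbabilityMeasure ν] (h : ExpIntegrable ν) (k : ℕ) (l : ℝ) :
    expMean ν l < expMean (upperApprox ν k) l := by
  simpa [upperApprox, expMean_neg, lt_neg] using expMean_lowerApprox_lt h.neg k (-l)

theorem stLEStar_lowerApprox_upperApprox [IsProbabilityMeasure μ] [IsProbabilityMeasure ν]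
    (hμ : ExpIntegrable μ) (hν : ExpIntegrable ν) (hle : ∀ l, expMean μ l ≤ expMean ν l) (k : ℕ) :
    StLEStar (lowerApprox μ k) (upperApprox ν k) :=
  stLEStar_of_expMean_lt (hμ.lowerApprox k) (hν.upperApprox k)
    (fun l => (expMean_lowerApprox_lt hμ k l).trans_le <|
      (hle l).trans (lt_expMean_upperApprox hν k l).le)
    (ae_lowerApprox_le μ k) (upperApprox_Ioi_ne_zero ν k k) (ae_le_upperApprox ν k)
    (lowerApprox_Iio_ne_zero μ k (-k))

/-! ### The topology on exponentially integrable measures -/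

theorem ExpMeasure.expIntegrable (μ : ExpMeasure) : ExpIntegrable μ.meas := μ.2

theorem continuous_integral_testFun {f : ℝ → ℝ} (hfc : Continuous f) (hf : Subexponential f) :
    Continuous fun μ : ExpMeasure => ∫ x, f x ∂μ.meas :=
  (continuous_apply (A := fun _ : TestFun => ℝ) ⟨f, hfc, hf⟩).comp
    (continuous_induced_dom (f := fun (μ : ExpMeasure) (f : TestFun) => ∫ x, f.1 x ∂μ.meas))

theorem tendsto_expMeasure_of_integral {ι : Type*} {F : Filter ι} {u : ι → ExpMeasure}
    {μ : ExpMeasure} (h : ∀ f : ℝ → ℝ, Continuous f → Subexponential f →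
      Tendsto (fun i => ∫ x, f x ∂(u i).meas) F (𝓝 (∫ x, f x ∂μ.meas))) :
    Tendsto u F (𝓝 μ) := by
  rw [nhds_induced, tendsto_comap_iff, tendsto_pi_nhds]
  exact fun f => h f.1 f.2.1 f.2.2

theorem subexponential_exp (l : ℝ) : Subexponential fun x => Real.exp (l * x) := by
  refine ⟨|l|, 1, fun x => ?_⟩
  rw [Real.abs_exp, one_mul, Real.exp_le_exp, ← abs_mul]
  exact le_abs_self _

theorem continuous_mgf_meas (l : ℝ) : Continuous fun μ : ExpMeasure => mgf id μ.meas l :=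
  continuous_integral_testFun (by fun_prop) (subexponential_exp l)

theorem isProbabilityMeasure_iff_mgf_zero : IsProbabilityMeasure μ ↔ mgf id μ 0 = 1 := by
  rw [isProbabilityMeasure_iff, mgf_zero', Measure.real, ENNReal.toReal_eq_one_iff]

theorem isClosed_probPairs : IsClosed probPairs := by
  simp only [probPairs, isProbabilityMeasure_iff_mgf_zero]
  exact (isClosed_eq ((continuous_mgf_meas 0).comp continuous_fst) continuous_const).inter
    (isClosed_eq ((continuous_mgf_meas 0).comp continuous_snd) continuous_const)

theorem isClosed_setOf_mgf_le : IsClosed {p : ExpMeasure × ExpMeasure | p ∈ probPairs ∧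
    (∀ l, 0 ≤ l → mgf id p.1.meas l ≤ mgf id p.2.meas l) ∧
    ∀ l ≤ 0, mgf id p.2.meas l ≤ mgf id p.1.meas l} := by
  have hfst (l : ℝ) := (continuous_mgf_meas l).comp (continuous_fst (Y := ExpMeasure))
  have hsnd (l : ℝ) := (continuous_mgf_meas l).comp (continuous_snd (X := ExpMeasure))
  simp only [Set.ofPred_and, Set.ofPred_forall]
  exact isClosed_probPairs.inter <|
    (isClosed_iInter fun l => isClosed_iInter fun _ => isClosed_le (hfst l) (hsnd l)).inter
      (isClosed_iInter fun l => isClosed_iInter fun _ => isClosed_le (hsnd l) (hfst l))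

theorem mem_closure_relR {μ ν : ExpMeasure} (hp : (μ, ν) ∈ probPairs)
    (hle : ∀ l, expMean μ.meas l ≤ expMean ν.meas l) : (μ, ν) ∈ closure relR := by
  obtain ⟨hμ, hν⟩ : IsProbabilityMeasure μ.meas ∧ IsProbabilityMeasure ν.meas := hp
  let u (k : ℕ) : ExpMeasure := ⟨lowerApprox μ.meas k, μ.expIntegrable.lowerApprox k⟩
  let v (k : ℕ) : ExpMeasure := ⟨upperApprox ν.meas k, ν.expIntegrable.upperApprox k⟩
  have hu : Tendsto u atTop (𝓝 μ) :=
    tendsto_expMeasure_of_integral fun _ hfc hf =>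
      tendsto_integral_lowerApprox μ.expIntegrable hfc hf
  have hv : Tendsto v atTop (𝓝 ν) :=
    tendsto_expMeasure_of_integral fun _ hfc hf =>
      tendsto_integral_upperApprox ν.expIntegrable hfc hf
  refine mem_closure_of_tendsto (hu.prodMk_nhds hv) (Eventually.of_forall fun k => ⟨⟨?_, ?_⟩, ?_⟩)
  · exact inferInstanceAs (IsProbabilityMeasure (lowerApprox μ.meas k))
  · exact inferInstanceAs (IsProbabilityMeasure (upperApprox ν.meas k))
  · exact stLEStar_lowerApprox_upperApprox μ.expIntegrable ν.expIntegrable hle k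

end StDom

theorem mainTheorem2 :
    closure StDom.relR =
      {p : StDom.ExpMeasure × StDom.ExpMeasure | p ∈ StDom.probPairs ∧
        (∀ l : ℝ, 0 ≤ l →
          ∫ x, Real.exp (l * x) ∂p.1.meas ≤ ∫ x, Real.exp (l * x) ∂p.2.meas) ∧
        (∀ l : ℝ, l ≤ 0 →
          ∫ x, Real.exp (l * x) ∂p.2.meas ≤ ∫ x, Real.exp (l * x) ∂p.1.meas)} := by
  refine Set.Subset.antisymm (closure_minimal ?_ StDom.isClosed_setOf_mgf_le) ?_
  · rintro ⟨μ, ν⟩ ⟨hp, hle⟩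
    have ⟨_, _⟩ := hp
    exact ⟨hp, (StDom.forall_expMean_le_iff μ.expIntegrable ν.expIntegrable).1
      (hle.expMean_le μ.expIntegrable ν.expIntegrable)⟩
  · rintro ⟨μ, ν⟩ ⟨hp, hle⟩
    have ⟨_, _⟩ := hp
    exact StDom.mem_closure_relR hp
      ((StDom.forall_expMean_le_iff μ.expIntegrable ν.expIntegrable).2 hle)
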